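/- Let $\mathcal H$ be a separable infinite-dimensional complex Hilbert space and let $\mathcal B(\mathcal H)$ be the algebra of bounded linear operators on $\mathcal H$. Let $\mathcal J$ be a two-sided ideal of $\mathcal B(\mathcal H)$ that is proper, i.e. $\{0\}\neq\mathcal J\neq\mathcal B(\mathcal H)$, and let $\mathcal U_{\mathcal J}(\mathcal H)=\mathcal U(\mathcal H)\cap(I+\mathcal J)$ be the set of unitary operators $U$ on $\mathcal H$ with $U-I\in\mathcal J$. Let $V_1,V_2\in\mathcal B(\mathcal H)$ be partial isometries, i.e. $V_i$ is isometric on the orthogonal complement of its kernel $N(V_i)$. Then there exists $U\in\mathcal U_{\mathcal J}(\mathcal H)$ such that $UV_1=V_2$ if and only if $V_1-V_2\in\mathcal J$ and $N(V_1)=N(V_2)$. -/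

import Mathlib

/-- A bounded operator `V` is a partial isometry if it is isometric on the orthogonal
complement of its kernel. -/
def IsPartialIsometry {H : Type*} [NormedAddCommGroup H] [InnerProductSpace ℂ H]
    (V : H →L[ℂ] H) : Prop :=
  ∀ x ∈ (LinearMap.ker (V : H →ₗ[ℂ] H))ᗮ, ‖V x‖ = ‖x‖

/-- An operator ideal is proper if it is neither zero nor the whole algebra `B(H)`. -/
def IsProperOperatorIdeal {H : Type*} [NormedAddCommGroup H] [InnerProductSpace ℂ H]
    (J : TwoSidedIdeal (H →L[ℂ] H)) : Prop :=
  J ≠ ⊥ ∧ J ≠ ⊤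

/-- The set `U_J(H) = U(H) ∩ (I + J)` of unitary operators that are perturbations of the
identity by an element of `J`. -/
def restrictedUnitary {H : Type*} [NormedAddCommGroup H] [InnerProductSpace ℂ H]
    [CompleteSpace H] (J : TwoSidedIdeal (H →L[ℂ] H)) : Set (H →L[ℂ] H) :=
  {U | U ∈ unitary (H →L[ℂ] H) ∧ ∃ A ∈ J, U = 1 + A}

open ContinuousLinearMap InnerProductSpace

section

variable {H : Type*} [NormedAddCommGroup H] [InnerProductSpace ℂ H] [CompleteSpace H]

/-! If the initial spaces agree, `A = intertwiner V₁ V₂` satisfies `A * V₁ = V₂` and lies in `1 +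
J`, but need not be invertible. By Calkin's theorem `A - 1` is compact, so both kernels of `A` and
`star A` are finite-dimensional. They are orthogonal to the ranges of `V₁` and `V₂` respectively, so
a finite-rank `F` carrying one into the other does not disturb `A * V₁ = V₂`. If `F` is injective on
`ker A`, then `A + F` is injective, hence invertible by the Fredholm alternative, and its polar part
is the required unitary. No index theory is needed: if the kernel dimensions compare the other way,
swap `V₁` and `V₂` and take the adjoint. -/

/-! ### Douglas factorization; ideals contain absolute values and adjoints -/

theorem ContinuousLinearMap.exists_eq_mul_of_norm_le (A B : H →L[ℂ] H)
    (h : ∀ x, ‖A x‖ ≤ ‖B x‖) : ∃ C : H →L[ℂ] H, A = C * B := by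
  let M : Submodule ℂ H := (LinearMap.range (B : H →ₗ[ℂ] H)).topologicalClosure
  have hM : ∀ x, B x ∈ M := fun x ↦
    Submodule.le_topologicalClosure _ (LinearMap.mem_range_self (B : H →ₗ[ℂ] H) x)
  let e : H →ₗ[ℂ] M := (B : H →ₗ[ℂ] H).codRestrict M hM
  have he : DenseRange e := by
    intro y
    rw [closure_subtype]
    have : (Subtype.val '' Set.range e) = (LinearMap.range (B : H →ₗ[ℂ] H) : Set H) := by
      ext z; simp [e]
    rw [this]
    exact y.2
  have : CompleteSpace M := (Submodule.isClosed_topologicalClosure _).completeSpace_coe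
  -- The map `B x ↦ A x` is a contraction on the range of `B`; extend it to the closure and by zero
  -- on the complement.
  refine ⟨((A : H →ₗ[ℂ] H).extendOfNorm e) ∘L M.orthogonalProjectionOnto, ?_⟩
  ext x
  have h1 : M.orthogonalProjectionOnto (B x) = e x :=
    Submodule.orthogonalProjectionOnto_mem_subspace_eq_self (K := M) (e x)
  have h2 := LinearMap.extendOfNorm_eq (f := (A : H →ₗ[ℂ] H)) he
    ⟨1, fun x ↦ by simpa [e] using h x⟩ x
  simp [h1, h2]

theorem ContinuousLinearMap.norm_cfcAbs_apply (T : H →L[ℂ] H) (x : H) :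
    ‖CFC.abs T x‖ = ‖T x‖ := by
  have hs : star (CFC.abs T) = CFC.abs T := (CFC.abs_nonneg T).isSelfAdjoint
  have h := CFC.abs_mul_abs T
  rw [apply_norm_eq_sqrt_inner_adjoint_left, apply_norm_eq_sqrt_inner_adjoint_left,
    ← star_eq_adjoint, ← star_eq_adjoint, hs, ← mul_def, ← mul_def, h]

theorem TwoSidedIdeal.cfcAbs_mem (J : TwoSidedIdeal (H →L[ℂ] H)) {T : H →L[ℂ] H} (hT : T ∈ J) :
    CFC.abs T ∈ J := by
  obtain ⟨C, hC⟩ := exists_eq_mul_of_norm_le (CFC.abs T) T fun x ↦ (norm_cfcAbs_apply T x).le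
  exact hC ▸ J.mul_mem_left _ _ hT

theorem TwoSidedIdeal.star_mem_of_mem (J : TwoSidedIdeal (H →L[ℂ] H)) {T : H →L[ℂ] H}
    (hT : T ∈ J) : star T ∈ J := by
  obtain ⟨C, hC⟩ := exists_eq_mul_of_norm_le T (CFC.abs T) fun x ↦ (norm_cfcAbs_apply T x).ge
  have hs : star (CFC.abs T) = CFC.abs T := (CFC.abs_nonneg T).isSelfAdjoint
  rw [hC, star_mul, hs]
  exact J.mul_mem_right _ _ (J.cfcAbs_mem hT)

/-! ### Compact and finite-rank operators -/

omit [CompleteSpace H] in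
theorem IsCompactOperator.of_finiteDimensional_range (T : H →L[ℂ] H)
    [FiniteDimensional ℂ (LinearMap.range (T : H →ₗ[ℂ] H))] : IsCompactOperator T := by
  let S : H →L[ℂ] LinearMap.range (T : H →ₗ[ℂ] H) :=
    T.codRestrict _ (LinearMap.mem_range_self (T : H →ₗ[ℂ] H))
  have : ProperSpace (LinearMap.range (T : H →ₗ[ℂ] H)) := FiniteDimensional.proper ℂ _
  have hS : IsCompactOperator S := (isCompactOperator_of_locallyCompactSpace_dom S :)
  exact hS.clm_comp (LinearMap.range (T : H →ₗ[ℂ] H)).subtypeL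

omit [CompleteSpace H] in
theorem Orthonormal.countable [TopologicalSpace.SeparableSpace H] {ι : Type*} {v : ι → H}
    (hv : Orthonormal ℂ v) : Countable ι := by
  rw [← Set.countable_univ_iff]
  -- Distinct orthonormal vectors are at distance `√2 > 1`, so these balls are disjoint.
  refine Set.PairwiseDisjoint.countable_of_isOpen (s := fun i ↦ Metric.ball (v i) (1 / 2)) ?_
    (fun i _ ↦ Metric.isOpen_ball) (fun i _ ↦ ⟨v i, Metric.mem_ball_self (by norm_num)⟩)
  intro i _ j _ hij
  refine Metric.ball_disjoint_ball ?_
  have h : ‖v i - v j‖ * ‖v i - v j‖ = 2 := by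
    rw [@norm_sub_mul_self ℂ, hv.1, hv.1, hv.2 hij]
    norm_num
  rw [dist_eq_norm]
  nlinarith [norm_nonneg (v i - v j)]

/-- The isometric embedding of a separable Hilbert space into any infinite-dimensional one. -/
theorem exists_linearIsometry_of_not_finiteDimensional [TopologicalSpace.SeparableSpace H]
    {M : Type*} [NormedAddCommGroup M] [InnerProductSpace ℂ M] [CompleteSpace M]
    (hM : ¬ FiniteDimensional ℂ M) : Nonempty (H →ₗᵢ[ℂ] M) := by
  obtain ⟨s, b, hb⟩ := exists_hilbertBasis ℂ H
  obtain ⟨t, c, hc⟩ := exists_hilbertBasis ℂ M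
  have := b.orthonormal.countable
  have ht : Infinite t := by
    by_contra h
    rw [not_infinite_iff_finite] at h
    have := Fintype.ofFinite t
    exact hM c.toOrthonormalBasis.toBasis.finiteDimensional_of_finite
  obtain ⟨f, hf⟩ := exists_injective_nat s
  have hv : Orthonormal ℂ (fun i : s ↦ c (Infinite.natEmbedding t (f i))) :=
    c.orthonormal.comp _ ((Infinite.natEmbedding t).injective.comp hf)
  exact ⟨(hv.orthogonalFamily.linearIsometry).comp b.repr.toLinearIsometry⟩

omit [CompleteSpace H] in
theorem TwoSidedIdeal.rankOne_mem {J : TwoSidedIdeal (H →L[ℂ] H)} (hJ : J ≠ ⊥) (x y : H) :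
    rankOne ℂ x y ∈ J := by
  obtain ⟨T, hT, hT0⟩ : ∃ T ∈ J, T ≠ 0 := by
    by_contra! h
    exact hJ (TwoSidedIdeal.ext fun T ↦ ⟨fun hT ↦ (TwoSidedIdeal.mem_bot _).2 (h T hT),
      fun hT ↦ (TwoSidedIdeal.mem_bot _).1 hT ▸ J.zero_mem⟩)
  obtain ⟨z, hz⟩ : ∃ z, T z ≠ 0 := by
    by_contra! h
    exact hT0 (ContinuousLinearMap.ext h)
  have h : rankOne ℂ x y = rankOne ℂ ((inner ℂ (T z) (T z))⁻¹ • x) (T z) * T * rankOne ℂ z y := by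
    ext w
    have h0 : (‖T z‖ : ℂ) ≠ 0 := by simpa using hz
    simp only [mul_apply_eq_comp, rankOne_apply, map_smul, inner_self_eq_norm_sq_to_K, RCLike.ofReal_eq_complex_ofReal]
    congr 1
    simp [h0]
  rw [h]
  exact J.mul_mem_right _ _ (J.mul_mem_left _ _ hT)

omit [CompleteSpace H] in
theorem TwoSidedIdeal.comp_orthogonalProjectionOnto_mem {J : TwoSidedIdeal (H →L[ℂ] H)}
    (hJ : J ≠ ⊥) (M : Submodule ℂ H) [FiniteDimensional ℂ M] (F : M →L[ℂ] H) :
    F ∘L M.orthogonalProjectionOnto ∈ J := by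
  have h : F ∘L M.orthogonalProjectionOnto
      = ∑ i, rankOne ℂ (F (stdOrthonormalBasis ℂ M i)) (stdOrthonormalBasis ℂ M i : H) := by
    ext x
    have := (stdOrthonormalBasis ℂ M).sum_repr' (M.orthogonalProjectionOnto x)
    rw [comp_apply, ← this, map_sum]
    simp
  rw [h]
  exact sum_mem fun i _ ↦ rankOne_mem hJ _ _

-- On this kernel `K` is minus the identity, which is therefore compact there.
omit [CompleteSpace H] in
theorem IsCompactOperator.finiteDimensional_ker_one_add {K : H →L[ℂ] H}
    (hK : IsCompactOperator K) :
    FiniteDimensional ℂ (LinearMap.ker ((1 + K : H →L[ℂ] H) : H →ₗ[ℂ] H)) := by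
  have hM : ∀ x ∈ LinearMap.ker ((1 + K : H →L[ℂ] H) : H →ₗ[ℂ] H), K x = -x := fun x hx ↦ by
    rw [LinearMap.mem_ker] at hx
    exact eq_neg_of_add_eq_zero_right (by simpa using hx)
  have hcl : IsClosed (LinearMap.ker ((1 + K : H →L[ℂ] H) : H →ₗ[ℂ] H) : Set H) :=
    (1 + K : H →L[ℂ] H).isClosed_ker
  have hr := IsCompactOperator.restrict (f := (K : H →ₗ[ℂ] H)) hK
    (V := LinearMap.ker ((1 + K : H →L[ℂ] H) : H →ₗ[ℂ] H))
    (fun x hx ↦ by simp [hM x hx]) hcl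
  refine FiniteDimensional.of_isCompactOperator_id (𝕜 := ℂ) ?_
  have hid : (id : LinearMap.ker ((1 + K : H →L[ℂ] H) : H →ₗ[ℂ] H) → _) =
      -⇑((K : H →ₗ[ℂ] H).restrict (fun x hx ↦ by simp [hM x hx])) :=
    funext fun x ↦ Subtype.ext (show (x : H) = -(K x) by rw [hM x x.2, neg_neg])
  exact hid ▸ hr.neg

theorem IsCompactOperator.isUnit_one_add {K : H →L[ℂ] H} (hK : IsCompactOperator K)
    (h : ∀ x, (1 + K) x = 0 → x = 0) : IsUnit (1 + K) := by
  rcases hK.hasEigenvalue_or_mem_resolventSet (μ := -1) (by norm_num) with h1 | h1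
  · obtain ⟨x, hx⟩ := h1.exists_hasEigenvector
    refine absurd (h x ?_) hx.2
    have := hx.apply_eq_smul
    simp at this
    simp [this]
  · rw [spectrum.mem_resolventSet_iff, ← IsUnit.neg_iff] at h1
    simpa [add_comm] using h1

/-! ### Initial projections of partial isometries -/

theorem ContinuousLinearMap.star_mul_self_eq_of_norm_eq {A B : H →L[ℂ] H}
    (h : ∀ x, ‖A x‖ = ‖B x‖) : star A * A = star B * B := by
  refine coe_injective ((ext_inner_map _ _).1 fun x ↦ ?_)
  simp [star_eq_adjoint, adjoint_inner_left, inner_self_eq_norm_sq_to_K, h]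

theorem IsPartialIsometry.star_mul_self_apply {V : H →L[ℂ] H} (hV : IsPartialIsometry V) :
    star V * V = (LinearMap.ker (V : H →ₗ[ℂ] H))ᗮ.starProjection := by
  have hc : CompleteSpace (LinearMap.ker (V : H →ₗ[ℂ] H)) := V.isClosed_ker.completeSpace_coe
  have hn : ∀ x, ‖V x‖ = ‖(LinearMap.ker (V : H →ₗ[ℂ] H))ᗮ.starProjection x‖ := fun x ↦ by
    rw [← hV _ (Submodule.starProjection_apply_mem _ x)]
    congr 1
    have := Submodule.starProjection_apply_mem (LinearMap.ker (V : H →ₗ[ℂ] H)) x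
    rw [LinearMap.mem_ker, coe_coe] at this
    simp [Submodule.starProjection_orthogonal', this]
  rw [star_mul_self_eq_of_norm_eq hn, isStarProjection_starProjection.isSelfAdjoint.star_eq,
    isStarProjection_starProjection.isIdempotentElem.eq]

theorem IsPartialIsometry.mul_star_mul_self {V : H →L[ℂ] H} (hV : IsPartialIsometry V) :
    V * (star V * V) = V := by
  have hc : CompleteSpace (LinearMap.ker (V : H →ₗ[ℂ] H)) := V.isClosed_ker.completeSpace_coe
  rw [hV.star_mul_self_apply]
  ext x
  have := Submodule.starProjection_apply_mem (LinearMap.ker (V : H →ₗ[ℂ] H)) x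
  rw [LinearMap.mem_ker, coe_coe] at this
  simp [Submodule.starProjection_orthogonal', this]

/-- **Calkin's theorem**: a proper ideal of operators on a separable Hilbert space consists of
compact operators. -/
theorem TwoSidedIdeal.isCompactOperator_of_mem [TopologicalSpace.SeparableSpace H]
    {J : TwoSidedIdeal (H →L[ℂ] H)} (hJ : J ≠ ⊤) {T : H →L[ℂ] H} (hT : T ∈ J) :
    IsCompactOperator T := by
  set S := CFC.abs T with hS
  have hS0 : 0 ≤ S := CFC.abs_nonneg T
  have hSJ : S ∈ J := J.cfcAbs_mem hT
  have hsa : IsSelfAdjoint S := hS0.isSelfAdjoint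
  suffices hc : IsCompactOperator S by
    obtain ⟨C, hC⟩ := exists_eq_mul_of_norm_le T S fun x ↦ (norm_cfcAbs_apply T x).ge
    rw [hC]
    exact hc.clm_comp C
  -- The truncations `(S - ε)₊` tend to `S`; each has finite rank, since otherwise `J` would contain
  -- `1`.
  let F : ℝ → H →L[ℂ] H := fun ε ↦ cfc (fun t : ℝ ↦ max (t - ε) 0) S
  have hspec : ∀ t ∈ spectrum ℝ S, 0 ≤ t := fun t ht ↦ spectrum_nonneg_of_nonneg hS0 ht
  have hbound : ∀ ε > 0, ‖F ε - S‖ ≤ ε := by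
    intro ε hε
    have h : F ε - S = cfc (fun t : ℝ ↦ max (t - ε) 0 - t) S := by
      rw [cfc_sub (fun t : ℝ ↦ max (t - ε) 0) (fun t ↦ t) S, cfc_id' ℝ S]
    rw [h]
    refine norm_cfc_le hε.le fun t ht ↦ ?_
    rw [Real.norm_eq_abs, abs_le]
    have := hspec t ht
    rcases max_cases (t - ε) 0 with h | h <;> constructor <;> linarith
  have hfin : ∀ ε > 0, FiniteDimensional ℂ (LinearMap.range (F ε : H →ₗ[ℂ] H)) := by
    intro ε hε
    by_contra hinf
    apply hJ
    rw [← TwoSidedIdeal.one_mem_iff]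
    let M := (LinearMap.range (F ε : H →ₗ[ℂ] H)).topologicalClosure
    have : CompleteSpace M := (Submodule.isClosed_topologicalClosure _).completeSpace_coe
    have hM : ¬ FiniteDimensional ℂ M := fun h ↦ hinf
      (Submodule.finiteDimensional_of_le (Submodule.le_topologicalClosure _))
    obtain ⟨V⟩ := exists_linearIsometry_of_not_finiteDimensional (H := H) hM
    -- `g` inverts `S` on the spectral part above `ε`, so `g * S` fixes the range of `F ε`;
    -- compressing it by an isometry of `H` into the closure of that range gives `1`.
    let g : H →L[ℂ] H := cfc (fun t : ℝ ↦ (max t ε)⁻¹) S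
    have hcont : Continuous fun t : ℝ ↦ (max t ε)⁻¹ :=
      (continuous_id.max continuous_const).inv₀ fun t ↦ (lt_max_of_lt_right hε).ne'
    have hg : g * S * F ε = F ε := by
      have h1 : g * S = cfc (fun t : ℝ ↦ (max t ε)⁻¹ * t) S := by
        rw [cfc_mul (fun t : ℝ ↦ (max t ε)⁻¹) (fun t ↦ t) S hcont.continuousOn, cfc_id' ℝ S]
      rw [h1, ← cfc_mul (fun t : ℝ ↦ (max t ε)⁻¹ * t) (fun t ↦ max (t - ε) 0) S
        (hcont.mul continuous_id).continuousOn]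
      refine cfc_congr fun t _ ↦ ?_
      rcases le_total t ε with h | h
      · simp [max_eq_right (sub_nonpos.2 h)]
      · simp [max_eq_left h, (hε.trans_le h).ne']
    have hgM : ∀ x ∈ M, (g * S) x = x := by
      have hcl : IsClosed {x : H | (g * S) x = x} :=
        isClosed_eq (g * S).continuous continuous_id
      refine fun x hx ↦ closure_minimal ?_ hcl hx
      rintro _ ⟨y, rfl⟩
      exact DFunLike.congr_fun hg y
    let W : H →L[ℂ] H := M.subtypeL ∘L V.toContinuousLinearMap
    have hW : star W * W = 1 := by
      rw [star_eq_adjoint, mul_def]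
      exact (norm_map_iff_adjoint_comp_self W).1 fun x ↦ V.norm_map x
    have h1 : star W * (g * S) * W = 1 := by
      rw [mul_assoc, ← hW]
      congr 1
      ext x
      exact hgM _ (V x).2
    rw [← h1]
    exact J.mul_mem_right _ _ (J.mul_mem_left _ _ (J.mul_mem_left _ _ hSJ))
  have hlim : Filter.Tendsto F (nhdsWithin 0 (Set.Ioi 0)) (nhds S) := by
    rw [tendsto_iff_norm_sub_tendsto_zero]
    refine squeeze_zero' (.of_forall fun _ ↦ norm_nonneg _) ?_
      (Filter.tendsto_id.mono_left nhdsWithin_le_nhds)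
    filter_upwards [self_mem_nhdsWithin] with ε hε using hbound ε hε
  refine isCompactOperator_of_tendsto hlim ?_
  filter_upwards [self_mem_nhdsWithin] with ε hε
  have := hfin ε hε
  exact IsCompactOperator.of_finiteDimensional_range (F ε)

/-- The unitary part of an invertible element of `1 + J` lies in `1 + J`. -/
theorem TwoSidedIdeal.exists_mem_restrictedUnitary {J : TwoSidedIdeal (H →L[ℂ] H)}
    {B : H →L[ℂ] H} (hB : IsUnit B) (hBJ : B - 1 ∈ J) :
    ∃ U ∈ restrictedUnitary J, ∀ W, star B * B * W = W → U * W = B * W := by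
  set S := CFC.abs B with hS
  have hS0 : 0 ≤ S := CFC.abs_nonneg B
  have hsa : star S = S := hS0.isSelfAdjoint
  have hSS : S * S = star B * B := CFC.abs_mul_abs B
  have hSu : IsUnit S := isUnit_mul_self_iff.1 (hSS ▸ hB.star.mul hB)
  have hS1 : IsUnit (S + 1) := by
    have h : (-1 : ℝ) ∉ spectrum ℝ S := fun h ↦ by
      linarith [spectrum_nonneg_of_nonneg hS0 h]
    rw [spectrum.notMem_iff, ← IsUnit.neg_iff] at h
    simpa [add_comm] using h
  obtain ⟨R, hR⟩ := hS1.exists_left_inv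
  obtain ⟨T, hST, hTS⟩ := isUnit_iff_exists.1 hSu
  have hTsa : star T = T := by
    have h : star T * S = 1 := by rw [← hsa, ← star_mul, hST, star_one]
    exact left_inv_eq_right_inv h hST
  have hSJ : S - 1 ∈ J := by
    -- The bracket is `S² - 1 = (S + 1)(S - 1)`, and `R` cancels `S + 1`.
    have h : S - 1 = R * (star B * (B - 1) + star (B - 1)) := by
      calc S - 1 = R * (S + 1) * (S - 1) := by rw [hR, one_mul]
        _ = R * (S * S - 1) := by noncomm_ring
        _ = _ := by rw [hSS, star_sub, star_one]; noncomm_ring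
    rw [h]
    exact J.mul_mem_left _ _ (J.add_mem (J.mul_mem_left _ _ hBJ) (J.star_mem_of_mem hBJ))
  have hUU : star (B * T) * (B * T) = 1 := by
    rw [star_mul, hTsa]
    calc T * star B * (B * T) = T * (star B * B) * T := by noncomm_ring
      _ = (T * S) * (S * T) := by rw [← hSS]; noncomm_ring
      _ = 1 := by rw [hTS, hST, one_mul]
  have hU : IsUnit (B * T) := hB.mul (isUnit_iff_exists.2 ⟨S, hTS, hST⟩)
  refine ⟨B * T, ⟨Unitary.mem_iff.2 ⟨hUU, ?_⟩, B * T - 1, ?_, by abel⟩, fun W hW ↦ ?_⟩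
  · obtain ⟨X, hX⟩ := hU.exists_right_inv
    rw [left_inv_eq_right_inv hUU hX, hX]
  · have h : B * T - 1 = ((B - 1) - (S - 1)) * T := by
      rw [sub_sub_sub_cancel_right, sub_mul, hST]
    rw [h]
    exact J.mul_mem_right _ _ (J.sub_mem hBJ hSJ)
  · have h : (S + 1) * (S - 1) * W = 0 := by
      calc (S + 1) * (S - 1) * W = S * S * W - W := by noncomm_ring
        _ = 0 := by rw [hSS, hW, sub_self]
    have hSW : S * W = W := by
      have h2 : (S - 1) * W = R * ((S + 1) * (S - 1) * W) := by
        rw [← mul_assoc, ← mul_assoc, hR, one_mul]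
      rw [h, mul_zero, sub_mul, one_mul, sub_eq_zero] at h2
      exact h2
    calc B * T * W = B * T * (S * W) := by rw [hSW]
      _ = B * (T * S) * W := by noncomm_ring
      _ = B * W := by rw [hTS, mul_one]

/-- For partial isometries with the same initial space, this operator maps the range of `V₁` onto
the range of `V₂` and the complement of the former into the complement of the latter. -/
noncomputable def intertwiner (V₁ V₂ : H →L[ℂ] H) : H →L[ℂ] H :=
  V₂ * star V₁ + (1 - V₂ * star V₂) * (1 - V₁ * star V₁)

theorem star_intertwiner (V₁ V₂ : H →L[ℂ] H) : star (intertwiner V₁ V₂) = intertwiner V₂ V₁ := by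
  simp [intertwiner]

theorem intertwiner_mul {V₁ V₂ : H →L[ℂ] H} (h₁ : V₁ * (star V₁ * V₁) = V₁)
    (h₂ : V₂ * (star V₂ * V₂) = V₂) (h : star V₁ * V₁ = star V₂ * V₂) :
    intertwiner V₁ V₂ * V₁ = V₂ := by
  have h0 : (1 - V₁ * star V₁) * V₁ = 0 := by rw [sub_mul, one_mul, mul_assoc, h₁, sub_self]
  rw [intertwiner, add_mul, mul_assoc, mul_assoc, h0, mul_zero, add_zero, h, h₂]

theorem intertwiner_sub_one_mem {J : TwoSidedIdeal (H →L[ℂ] H)} {V₁ V₂ : H →L[ℂ] H}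
    (h₁ : V₁ * (star V₁ * V₁) = V₁) (hJ : V₁ - V₂ ∈ J) : intertwiner V₁ V₂ - 1 ∈ J := by
  have h0 : star V₁ * (1 - V₁ * star V₁) = 0 := by
    have := congrArg star h₁
    simp only [star_mul, star_star] at this
    rw [mul_sub, mul_one, ← mul_assoc, this, sub_self]
  -- Since `star V₁` kills `1 - V₁ * star V₁`, the factor `star V₂` before it may be replaced by
  -- `star (V₂ - V₁)`.
  have h : intertwiner V₁ V₂ - 1 =
      V₂ * star (V₁ - V₂) * (1 - V₁ * star V₁) - (V₁ - V₂) * star V₁ := by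
    calc intertwiner V₁ V₂ - 1 = V₂ * (0 - star V₂ * (1 - V₁ * star V₁))
          - (V₁ - V₂) * star V₁ := by rw [intertwiner]; noncomm_ring
      _ = _ := by rw [← h0, star_sub]; noncomm_ring
  rw [h]
  exact J.sub_mem (J.mul_mem_right _ _ (J.mul_mem_left _ _ (J.star_mem_of_mem hJ)))
    (J.mul_mem_right _ _ hJ)

theorem exists_restrictedUnitary_of_finrank_le {J : TwoSidedIdeal (H →L[ℂ] H)} (hJ : J ≠ ⊥)
    (hc : ∀ T ∈ J, IsCompactOperator T) {V₁ V₂ : H →L[ℂ] H} (h₁ : V₁ * (star V₁ * V₁) = V₁)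
    (h₂ : V₂ * (star V₂ * V₂) = V₂) (h : star V₁ * V₁ = star V₂ * V₂) (hV : V₁ - V₂ ∈ J)
    (hle : Module.finrank ℂ (LinearMap.ker (intertwiner V₁ V₂ : H →ₗ[ℂ] H)) ≤
      Module.finrank ℂ (LinearMap.ker (intertwiner V₂ V₁ : H →ₗ[ℂ] H))) :
    ∃ U ∈ restrictedUnitary J, U * V₁ = V₂ := by
  have hV' : V₂ - V₁ ∈ J := by simpa using J.neg_mem hV
  set A := intertwiner V₁ V₂ with hA
  have hAs : star A = intertwiner V₂ V₁ := star_intertwiner _ _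
  rw [← hAs] at hle
  have hAJ : A - 1 ∈ J := intertwiner_sub_one_mem h₁ hV
  have hAsJ : star A - 1 ∈ J := hAs ▸ intertwiner_sub_one_mem h₂ hV'
  have hA1 : A * V₁ = V₂ := intertwiner_mul h₁ h₂ h
  have hA2 : star A * V₂ = V₁ := hAs ▸ intertwiner_mul h₂ h₁ h.symm
  let N := LinearMap.ker (A : H →ₗ[ℂ] H)
  let N' := LinearMap.ker ((star A : H →L[ℂ] H) : H →ₗ[ℂ] H)
  -- Finiteness makes `hle` meaningful: `finrank` would be `0` on an infinite-dimensional kernel.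
  have : FiniteDimensional ℂ N := by
    have := (hc _ hAJ).finiteDimensional_ker_one_add
    rwa [add_sub_cancel] at this
  have : FiniteDimensional ℂ N' := by
    have := (hc _ hAsJ).finiteDimensional_ker_one_add
    rwa [add_sub_cancel] at this
  obtain ⟨f, hf⟩ : ∃ f : N →ₗ[ℂ] N', Function.Injective f :=
    finrank_le_iff_exists_linearMap.1 hle
  let F : H →L[ℂ] H := (N'.subtypeL ∘L f.toContinuousLinearMap) ∘L N.orthogonalProjectionOnto
  have hFJ : F ∈ J := TwoSidedIdeal.comp_orthogonalProjectionOnto_mem hJ _ _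
  have hF' : ∀ x, star A (F x) = 0 := fun x ↦ (f (N.orthogonalProjectionOnto x)).2
  -- `V₁ = star A * V₂` has range orthogonal to `ker A`, where `F` is supported.
  have hFV : F * V₁ = 0 := by
    ext x
    have : N.orthogonalProjectionOnto (V₁ x) = 0 := by
      rw [Submodule.orthogonalProjectionOnto_eq_zero_iff, Submodule.mem_orthogonal]
      intro y hy
      rw [← hA2, mul_apply_eq_comp, star_eq_adjoint, adjoint_inner_right]
      simp [show A y = 0 from hy]
    simp [F, this]
  have hFV' : star F * V₂ = 0 := by
    have h0 : star A * F = 0 := by ext x; exact hF' x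
    rw [← hA1, ← mul_assoc, ← star_star A, ← star_mul, h0, star_zero, zero_mul]
  have hBu : IsUnit (A + F) := by
    have hB1 : A + F = 1 + (A - 1 + F) := by abel
    rw [hB1]
    refine (hc _ (J.add_mem hAJ hFJ)).isUnit_one_add fun x hx ↦ ?_
    rw [← hB1, add_apply] at hx
    -- `A x = -F x` lies in both the range of `A` and the kernel of `star A`, which are orthogonal.
    have hAx : A x = 0 := by
      have h3 : A x = -F x := eq_neg_of_add_eq_zero_left hx
      have h4 : star A (A x) = 0 := by rw [h3, map_neg, hF', neg_zero]
      have := ker_adjoint_comp_self A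
      exact this.le h4
    have hxN : N.orthogonalProjectionOnto x = ⟨x, hAx⟩ :=
      Submodule.orthogonalProjectionOnto_mem_subspace_eq_self (⟨x, hAx⟩ : N)
    have hfx : f ⟨x, hAx⟩ = 0 := by
      apply Subtype.ext
      have : F x = 0 := by simpa [hAx] using hx
      simpa [F, hxN] using this
    exact congrArg Subtype.val (hf (hfx.trans (map_zero f).symm))
  obtain ⟨U, hU, hUW⟩ := TwoSidedIdeal.exists_mem_restrictedUnitary (J := J) hBu
    (by rw [add_sub_right_comm]; exact J.add_mem hAJ hFJ)
  have hBV : (A + F) * V₁ = V₂ := by rw [add_mul, hA1, hFV, add_zero]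
  refine ⟨U, hU, ?_⟩
  rw [hUW V₁ ?_, hBV]
  rw [mul_assoc, hBV, star_add, add_mul, hA2, hFV', add_zero]

end

theorem proposition3p8 {H : Type*} [NormedAddCommGroup H] [InnerProductSpace ℂ H]
    [CompleteSpace H] [TopologicalSpace.SeparableSpace H] (hH : ¬ FiniteDimensional ℂ H)
    (J : TwoSidedIdeal (H →L[ℂ] H)) (hJ : IsProperOperatorIdeal J)
    (V₁ V₂ : H →L[ℂ] H) (hV₁ : IsPartialIsometry V₁) (hV₂ : IsPartialIsometry V₂) :
    (∃ U ∈ restrictedUnitary J, U * V₁ = V₂) ↔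
      (V₁ - V₂ ∈ J ∧
        LinearMap.ker (V₁ : H →ₗ[ℂ] H) = LinearMap.ker (V₂ : H →ₗ[ℂ] H)) := by
  constructor
  · rintro ⟨U, ⟨hU, A, hA, rfl⟩, rfl⟩
    constructor
    · have h : V₁ - (1 + A) * V₁ = -(A * V₁) := by noncomm_ring
      rw [h]
      exact J.neg_mem (J.mul_mem_right _ _ hA)
    · ext x
      have h : V₁ = star (1 + A) * ((1 + A) * V₁) := by
        rw [← mul_assoc, Unitary.star_mul_self_of_mem hU, one_mul]
      simp only [LinearMap.mem_ker, coe_coe]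
      constructor <;> intro hx
      · rw [mul_apply_eq_comp, hx, map_zero]
      · rw [h, mul_apply_eq_comp, hx, map_zero]
  · rintro ⟨hV, hker⟩
    have h₁ := hV₁.mul_star_mul_self
    have h₂ := hV₂.mul_star_mul_self
    have h : star V₁ * V₁ = star V₂ * V₂ := by
      rw [hV₁.star_mul_self_apply, hV₂.star_mul_self_apply]
      simp only [hker]
    have hc : ∀ T ∈ J, IsCompactOperator T := fun T ↦ TwoSidedIdeal.isCompactOperator_of_mem hJ.2
    rcases le_total (Module.finrank ℂ (LinearMap.ker (intertwiner V₁ V₂ : H →ₗ[ℂ] H)))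
      (Module.finrank ℂ (LinearMap.ker (intertwiner V₂ V₁ : H →ₗ[ℂ] H))) with hle | hle
    · exact exists_restrictedUnitary_of_finrank_le hJ.1 hc h₁ h₂ h hV hle
    · obtain ⟨U, ⟨hU, A, hA, hUA⟩, hUV⟩ := exists_restrictedUnitary_of_finrank_le hJ.1 hc h₂ h₁
        h.symm (by simpa using J.neg_mem hV) hle
      refine ⟨star U, ⟨Unitary.star_mem hU, star A, J.star_mem_of_mem hA, by simp [hUA]⟩, ?_⟩
      rw [← hUV, ← mul_assoc, Unitary.star_mul_self_of_mem hU, one_mul]
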